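/- Let $\rho,\sigma$ be density operators (positive semidefinite, unit trace) on a finite-dimensional complex Hilbert space $\mathcal H$. All logarithms are to base $2$, with $\log 0=-\infty$ for error probabilities. Let $$D(\rho\|\sigma)=\begin{cases}\operatorname{Tr}\rho(\log\rho-\log\sigma), & \operatorname{supp}\rho\subseteq\operatorname{supp}\sigma,\\ +\infty, & \text{otherwise,}\end{cases}$$ be the quantum relative entropy, where the operator logarithms are taken on the supports. A test on $\mathcal H^{\otimes n}$ is an operator $\Pi_n$ with $0\le\Pi_n\le I_n$. Say that $R\in\mathbb R$ has the strong converse property if every sequence of tests $(\Pi_n)_{n\in\mathbb N}$ with $$\limsup_{n\to\infty}\frac1n\log\operatorname{Tr}\Pi_n\sigma^{\otimes n}\le -R$$ satisfies $\lim_{n\to\infty}\operatorname{Tr}(I_n-\Pi_n)\rho^{\otimes n}=1$. Let the asymptotic strong converse rate $R_{sc}\in[-\infty,+\infty]$ of the hypothesis testing problem $H_0:\rho$ versus $H_1:\sigma$ be the infimum of all $R\in\mathbb R$ with this property ($+\infty$ if there is none). Then $$R_{sc}=D(\rho\|\sigma),$$ and every real $R>D(\rho\|\sigma)$ has the strong converse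 property. -/

import Mathlib

open Filter Topology
open scoped Matrix ComplexOrder

noncomputable section

namespace QHT

/-- Density operators on the Hilbert space with orthonormal basis `ι`: positive semidefinite
operators of unit trace. -/
def IsState {ι : Type*} [Fintype ι] (ρ : Matrix ι ι ℂ) : Prop :=
  ρ.PosSemidef ∧ ρ.trace = 1

/-- A test, i.e. an operator `P` with `0 ≤ P ≤ I`; it represents the POVM `{P, I - P}`. -/
def IsTest {ι : Type*} [Fintype ι] [DecidableEq ι] (P : Matrix ι ι ℂ) : Prop :=
  P.PosSemidef ∧ (1 - P).PosSemidef

/-- The `n`-fold tensor power of an operator, in the product basis `Fin n → ι`. -/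
def tensorPow {ι : Type*} (A : Matrix ι ι ℂ) (n : ℕ) :
    Matrix (Fin n → ι) (Fin n → ι) ℂ :=
  Matrix.of fun i j => ∏ k, A (i k) (j k)

/-- The type I error `Tr (I - P) ρ` of the test `P`. -/
def typeI {ι : Type*} [Fintype ι] [DecidableEq ι] (P ρ : Matrix ι ι ℂ) : ℝ :=
  ((1 - P) * ρ).trace.re

/-- The type II error `Tr P σ` of the test `P`. -/
def typeII {ι : Type*} [Fintype ι] (P σ : Matrix ι ι ℂ) : ℝ :=
  (P * σ).trace.re

/-- The support of a positive semidefinite operator, i.e. its range. -/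
def supp {ι : Type*} [Fintype ι] (A : Matrix ι ι ℂ) : Submodule ℂ (ι → ℂ) :=
  LinearMap.range A.mulVecLin

open scoped Classical in
/-- The quantum relative entropy `D(ρ‖σ)`, with logarithms to base `2`: it is
`Tr ρ (log ρ - log σ)` if `supp ρ ⊆ supp σ` and `+∞` otherwise. The logarithms are given by the
functional calculus, with `log` taken to be `0` at the eigenvalue `0`, that is, they are taken
on the supports. -/
def relEntropy {ι : Type*} [Fintype ι] [DecidableEq ι] (ρ σ : Matrix ι ι ℂ) : EReal :=
  if supp ρ ≤ supp σ then
    (((ρ * (cfc (Real.logb 2) ρ - cfc (Real.logb 2) σ)).trace.re : ℝ) : EReal)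
  else ⊤

/-- The base `2` logarithm of a nonnegative number, with `log 0 = -∞`. -/
def log2 (x : ℝ) : EReal :=
  if x ≤ 0 then ⊥ else ((Real.logb 2 x : ℝ) : EReal)

/-- The number `R` has the strong converse property: every sequence of tests whose type II errors
satisfy `limsup (1/n) log Tr (P n) σ^{⊗n} ≤ -R` has type I errors converging to one. -/
def IsStrongConverse {ι : Type*} [Fintype ι] [DecidableEq ι] (ρ σ : Matrix ι ι ℂ) (R : ℝ) :
    Prop :=
  ∀ P : (n : ℕ) → Matrix (Fin n → ι) (Fin n → ι) ℂ, (∀ n, IsTest (P n)) →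
    limsup (fun n : ℕ => (((1 / n : ℝ)) : EReal) * log2 (typeII (P n) (tensorPow σ n))) atTop
      ≤ ((-R : ℝ) : EReal) →
    Tendsto (fun n : ℕ => typeI (P n) (tensorPow ρ n)) atTop (𝓝 1)

/-- The asymptotic strong converse rate: the infimum, in the extended reals, of the numbers with
the strong converse property (`+∞` if there are none). -/
def strongConverseRate {ι : Type*} [Fintype ι] [DecidableEq ι] (ρ σ : Matrix ι ι ℂ) : EReal :=
  sInf ((fun R : ℝ => (R : EReal)) '' {R : ℝ | IsStrongConverse ρ σ R})

end QHT

end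

/-!
The obstruction to reducing to classical hypothesis testing is that `ρ^{⊗n}` and `σ^{⊗n}` do not
commute. It is removed by the pinching inequality `P ≤ 2 (E P E + (1 - E) P (1 - E))`, which holds
for every projection `E` because `(2 E - 1) P (2 E - 1) ≥ 0`; its factor `2` does not affect
exponents.

Take for `E` the projection onto the eigenspaces of `σ^{⊗n}` on which `(1/n) log σ^{⊗n}` is
`δ`-close to `Tr ρ log σ`, and for `F` the same projection with `ρ` in place of `σ`. When
`supp ρ ⊆ supp σ`, the weak law of large numbers, applied to the measurement of `ρ` in an eigenbasis
of `σ` and of `ρ` respectively, shows that `E` and `F` have vanishing type I error.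

For the strong converse, `F ρ^{⊗n} F ≤ 2^{n (Tr ρ log ρ + δ)}` and
`2^{n (Tr ρ log σ - δ)} E ≤ σ^{⊗n}`, so pinching by `E` bounds `Tr P ρ^{⊗n}` by
`2 · 2^{n (D + 2 δ)} Tr P σ^{⊗n}` up to vanishing terms. Conversely, the test `E F E` has type II
error at most `2^{-n (D - 2 δ)}`, and pinching `F` by `E` shows that its type I error is
asymptotically at most `1/2`, which is enough to refute the strong converse property at rates below
`D`. When `supp ρ ⊄ supp σ`, the tests `1 - Q^{⊗n}`, with `Q` the support projection of `σ`, have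
type II error zero and type I error `(Tr Q ρ)^n → 0`.
-/

noncomputable section

namespace QHT

open scoped MatrixOrder

section StarOrderedRing

variable {R : Type*} [Ring R] [StarRing R] [PartialOrder R] [StarOrderedRing R] {e a : R}

lemma le_two_nsmul_pinching (he : IsSelfAdjoint e) (ha : 0 ≤ a) :
    a ≤ 2 • (e * a * e + (1 - e) * a * (1 - e)) := by
  have h : 0 ≤ (2 • e - 1) * a * (2 • e - 1) :=
    ((IsSelfAdjoint.all 2).smul he |>.sub (.one R)).conjugate_nonneg ha
  rw [← sub_nonneg]
  convert h using 1
  simp only [two_nsmul]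
  noncomm_ring

lemma conjugate_le_of_isStarProjection (he : IsStarProjection e) (ha : a ≤ 1) :
    e * a * e ≤ e := by
  simpa [he.isIdempotentElem.eq] using he.isSelfAdjoint.conjugate_le_conjugate ha

lemma conjugate_le_of_commute (he : IsStarProjection e) (hea : Commute e a) (ha : 0 ≤ a) :
    e * a * e ≤ a := by
  have h : 0 ≤ (1 - e) * a * (1 - e) := he.one_sub.isSelfAdjoint.conjugate_nonneg ha
  rw [← sub_nonneg]
  convert h using 1
  simp only [mul_sub, sub_mul, mul_one, one_mul, hea.eq, mul_assoc, he.isIdempotentElem.eq]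
  abel

end StarOrderedRing

section Trace

variable {κ 𝕜 : Type*} [Fintype κ] [RCLike 𝕜] {A B C : Matrix κ κ 𝕜}

lemma trace_mul_nonneg (hA : 0 ≤ A) (hB : 0 ≤ B) : 0 ≤ (A * B).trace := by
  classical
  obtain ⟨C, rfl⟩ := CStarAlgebra.nonneg_iff_eq_star_mul_self.mp hA
  rw [Matrix.mul_assoc, Matrix.trace_mul_comm]
  exact (Matrix.nonneg_iff_posSemidef.mp (star_right_conjugate_nonneg hB C)).trace_nonneg

lemma trace_mul_eq_zero_iff (hA : 0 ≤ A) (hB : 0 ≤ B) : (A * B).trace = 0 ↔ A * B = 0 := by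
  classical
  refine ⟨fun h => ?_, fun h => by rw [h, Matrix.trace_zero]⟩
  obtain ⟨C, rfl⟩ := CStarAlgebra.nonneg_iff_eq_star_mul_self.mp hA
  obtain ⟨D, rfl⟩ := CStarAlgebra.nonneg_iff_eq_mul_star_self.mp hB
  have hCD : C * D = 0 := by
    rw [← Matrix.trace_mul_conjTranspose_self_eq_zero_iff, ← h, Matrix.trace_mul_comm _ (D * _)]
    simp only [← Matrix.star_eq_conjTranspose, star_mul, Matrix.mul_assoc]
    rw [Matrix.trace_mul_comm]
    simp only [Matrix.mul_assoc]
  rw [Matrix.mul_assoc, ← Matrix.mul_assoc C, hCD, Matrix.zero_mul, Matrix.mul_zero]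

lemma trace_mul_le_trace_mul_left (hC : 0 ≤ C) (h : A ≤ B) : (C * A).trace ≤ (C * B).trace := by
  simpa only [Matrix.mul_sub, Matrix.trace_sub, sub_nonneg] using
    trace_mul_nonneg hC (sub_nonneg.mpr h)

lemma trace_mul_le_trace_mul_right (hC : 0 ≤ C) (h : A ≤ B) : (A * C).trace ≤ (B * C).trace := by
  simpa only [Matrix.trace_mul_comm _ C] using trace_mul_le_trace_mul_left hC h

lemma trace_le_trace (h : A ≤ B) : A.trace ≤ B.trace :=
  sub_nonneg.mp <| Matrix.trace_sub B A ▸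
    (Matrix.nonneg_iff_posSemidef.mp (sub_nonneg.mpr h)).trace_nonneg

end Trace

section SpectralProjection

variable {κ 𝕜 : Type*} [Fintype κ] [DecidableEq κ] [RCLike 𝕜] {A : Matrix κ κ 𝕜} {S : Set ℝ}

/-- The spectral projection of a Hermitian matrix `A` onto the eigenspaces with eigenvalue
in `S`. -/
def spectralProj (A : Matrix κ κ 𝕜) (S : Set ℝ) : Matrix κ κ 𝕜 :=
  cfc (S.indicator 1) A

lemma isStarProjection_spectralProj (A : Matrix κ κ 𝕜) (S : Set ℝ) :
    IsStarProjection (spectralProj A S) where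
  isIdempotentElem := by
    have hcont := A.finite_real_spectrum.continuousOn (S.indicator (1 : ℝ → ℝ))
    rw [IsIdempotentElem, spectralProj, ← cfc_mul _ _ A hcont hcont]
    congr! 2 with x
    by_cases hx : x ∈ S <;> simp [hx]
  isSelfAdjoint := cfc_predicate _ _

lemma commute_spectralProj (A : Matrix κ κ 𝕜) (S : Set ℝ) : Commute (spectralProj A S) A :=
  (Commute.refl A).cfc_real _

lemma smul_spectralProj_le (hA : 0 ≤ A) {a : ℝ} (hS : S ⊆ Set.Ici a) :
    a • spectralProj A S ≤ A := by
  have hcont (f : ℝ → ℝ) : ContinuousOn f (spectrum ℝ A) := A.finite_real_spectrum.continuousOn f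
  conv_rhs => rw [← cfc_id ℝ A]
  rw [spectralProj, ← cfc_smul a _ A (hcont _)]
  refine cfc_mono (fun x hx => ?_) (hcont _) (hcont _)
  by_cases hxS : x ∈ S
  · simpa [hxS] using hS hxS
  · simpa [hxS] using spectrum_nonneg_of_nonneg hA hx

lemma spectralProj_mul (hA : IsSelfAdjoint A) (S : Set ℝ) :
    spectralProj A S * A = cfc (S.indicator id) A := by
  conv_lhs => enter [2]; rw [← cfc_id ℝ A]
  rw [spectralProj,
    ← cfc_mul _ _ A (A.finite_real_spectrum.continuousOn _) (A.finite_real_spectrum.continuousOn _)]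
  congr! 1
  ext x
  by_cases hx : x ∈ S <;> simp [hx]

lemma conjugate_spectralProj_le (hA : IsSelfAdjoint A) {b : ℝ} (hb : 0 ≤ b) (hS : S ⊆ Set.Iic b) :
    spectralProj A S * A * spectralProj A S ≤ b • 1 := by
  rw [Matrix.mul_assoc, ← (commute_spectralProj A S).eq, ← Matrix.mul_assoc,
    (isStarProjection_spectralProj A S).isIdempotentElem.eq, spectralProj_mul hA,
    ← Algebra.algebraMap_eq_smul_one]
  exact cfc_le_algebraMap _ b A
    (fun x _ => Set.indicator_le' (fun x hx => hS hx) (fun _ _ => hb) x)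
    (A.finite_real_spectrum.continuousOn _)

lemma spectralProj_compl_zero_mul (hA : IsSelfAdjoint A) : spectralProj A {0}ᶜ * A = A := by
  conv_rhs => rw [← cfc_id ℝ A]
  rw [spectralProj_mul hA, Set.indicator_eq_self.mpr]
  exact fun x hx => hx

lemma spectralProj_compl_zero (hA : IsSelfAdjoint A) :
    spectralProj A {0}ᶜ = A * cfc (fun x : ℝ => x⁻¹) A := by
  conv_rhs => enter [1]; rw [← cfc_id ℝ A]
  rw [spectralProj,
    ← cfc_mul _ _ A (A.finite_real_spectrum.continuousOn _) (A.finite_real_spectrum.continuousOn _)]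
  congr! 1
  ext x
  by_cases hx : x = 0 <;> simp [hx]

lemma cfc_conj_diagonal {U : Matrix κ κ 𝕜} (hU : U ∈ Matrix.unitaryGroup κ 𝕜) (f : ℝ → ℝ)
    (a : κ → ℝ) :
    cfc f (U * Matrix.diagonal (fun i => (a i : 𝕜)) * star U) =
      U * Matrix.diagonal (fun i => (f (a i) : 𝕜)) * star U := by
  let φ : (κ → ℝ) →ₐ[ℝ] Matrix κ κ 𝕜 :=
    (((Unitary.conjStarAlgAut 𝕜 _ ⟨U, hU⟩).toAlgEquiv : _ →ₐ[𝕜] _).comp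
      (Matrix.diagonalAlgHom 𝕜)).restrictScalars ℝ |>.comp
        ((Algebra.ofId ℝ 𝕜).compLeft κ)
  have hfin := ((Set.finite_range a).union (φ a).finite_real_spectrum)
  obtain ⟨p, hp⟩ : ∃ p : Polynomial ℝ, ∀ x ∈ Set.range a ∪ spectrum ℝ (φ a), p.eval x = f x :=
    ⟨Lagrange.interpolate hfin.toFinset id f, fun x hx =>
      Lagrange.eval_interpolate_at_node f Function.injective_id.injOn (hfin.mem_toFinset.mpr hx)⟩
  have hpa : Polynomial.aeval a p = fun i => f (a i) := by
    ext i
    rw [← hp (a i) (.inl ⟨i, rfl⟩), ← Polynomial.coe_aeval_eq_eval]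
    exact (Polynomial.aeval_algHom_apply (Pi.evalAlgHom ℝ _ i) a p).symm
  have hself : IsSelfAdjoint (φ a) :=
    Matrix.isHermitian_mul_mul_conjTranspose U <|
      Matrix.isHermitian_diagonal_iff.mpr fun i => RCLike.conj_ofReal (a i)
  calc cfc f (φ a) = cfc p.eval (φ a) := cfc_congr fun x hx => (hp x (.inr hx)).symm
    _ = φ (fun i => f (a i)) := by
      rw [cfc_polynomial p _ hself, Polynomial.aeval_algHom_apply, hpa]

end SpectralProjection

section TensorPow

variable {ι : Type*}

lemma tensorPow_conjTranspose (A : Matrix ι ι ℂ) (n : ℕ) :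
    tensorPow Aᴴ n = (tensorPow A n)ᴴ := by
  ext I J
  simp [tensorPow]

lemma tensorPow_diagonal [DecidableEq ι] (a : ι → ℂ) (n : ℕ) :
    tensorPow (Matrix.diagonal a) n = Matrix.diagonal (fun I : Fin n → ι => ∏ k, a (I k)) := by
  ext I J
  by_cases h : I = J
  · simp [h, tensorPow]
  · obtain ⟨k, hk⟩ := Function.ne_iff.mp h
    rw [Matrix.diagonal_apply_ne _ h]
    exact Finset.prod_eq_zero (Finset.mem_univ k) (Matrix.diagonal_apply_ne _ hk)

lemma tensorPow_one [DecidableEq ι] (n : ℕ) : tensorPow (1 : Matrix ι ι ℂ) n = 1 := by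
  rw [← Matrix.diagonal_one, tensorPow_diagonal]
  simp

variable [Fintype ι]

lemma tensorPow_mul (A B : Matrix ι ι ℂ) (n : ℕ) :
    tensorPow (A * B) n = tensorPow A n * tensorPow B n := by
  ext I J
  simp only [tensorPow, Matrix.of_apply, Matrix.mul_apply, ← Finset.prod_mul_distrib]
  rw [Finset.prod_univ_sum, Fintype.piFinset_univ]

lemma trace_tensorPow (A : Matrix ι ι ℂ) (n : ℕ) : (tensorPow A n).trace = A.trace ^ n := by
  simp only [Matrix.trace, Matrix.diag_apply, tensorPow, Matrix.of_apply]
  rw [← Fin.prod_const, Finset.prod_univ_sum, Fintype.piFinset_univ]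

lemma tensorPow_nonneg {κ : Type*} [Finite κ] {A : Matrix κ κ ℂ} (hA : 0 ≤ A) (n : ℕ) :
    0 ≤ tensorPow A n := by
  classical
  have := Fintype.ofFinite κ
  obtain ⟨C, rfl⟩ := CStarAlgebra.nonneg_iff_eq_star_mul_self.mp hA
  rw [tensorPow_mul, Matrix.star_eq_conjTranspose, tensorPow_conjTranspose]
  exact star_mul_self_nonneg _

lemma isStarProjection_tensorPow {E : Matrix ι ι ℂ} (hE : IsStarProjection E) (n : ℕ) :
    IsStarProjection (tensorPow E n) where
  isIdempotentElem := by rw [IsIdempotentElem, ← tensorPow_mul, hE.isIdempotentElem.eq]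
  isSelfAdjoint := by
    rw [isSelfAdjoint_iff, Matrix.star_eq_conjTranspose, ← tensorPow_conjTranspose,
      ← Matrix.star_eq_conjTranspose, hE.isSelfAdjoint.star_eq]

lemma tensorPow_mem_unitaryGroup [DecidableEq ι] {U : Matrix ι ι ℂ}
    (hU : U ∈ Matrix.unitaryGroup ι ℂ) (n : ℕ) :
    tensorPow U n ∈ Matrix.unitaryGroup (Fin n → ι) ℂ := by
  rw [Matrix.mem_unitaryGroup_iff, Matrix.star_eq_conjTranspose, ← tensorPow_conjTranspose,
    ← tensorPow_mul, ← Matrix.star_eq_conjTranspose, Matrix.mem_unitaryGroup_iff.mp hU,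
    tensorPow_one]

end TensorPow

section OutcomeWeight

variable {ι : Type*} [Fintype ι] {U A : Matrix ι ι ℂ}

/-- The weight `⟨uᵢ, A uᵢ⟩` of the outcome `i` when `A` is measured in the basis of columns `uᵢ` of
`U`; for a state `A` and a unitary `U` these are probabilities. -/
def outcomeWeight (U A : Matrix ι ι ℂ) (i : ι) : ℝ := ((star U * A * U) i i).re

lemma ofReal_outcomeWeight (hA : 0 ≤ A) (U : Matrix ι ι ℂ) (i : ι) :
    (outcomeWeight U A i : ℂ) = (star U * A * U) i i :=
  (Complex.eq_re_of_ofReal_le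
    (Matrix.nonneg_iff_posSemidef.mp (star_left_conjugate_nonneg hA U)).diag_nonneg).symm

lemma outcomeWeight_nonneg (hA : 0 ≤ A) (U : Matrix ι ι ℂ) (i : ι) : 0 ≤ outcomeWeight U A i :=
  Complex.zero_le_real.mp <| ofReal_outcomeWeight hA U i ▸
    (Matrix.nonneg_iff_posSemidef.mp (star_left_conjugate_nonneg hA U)).diag_nonneg

lemma outcomeWeight_tensorPow (hA : 0 ≤ A) (U : Matrix ι ι ℂ) {n : ℕ} (I : Fin n → ι) :
    outcomeWeight (tensorPow U n) (tensorPow A n) I = ∏ k, outcomeWeight U A (I k) := by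
  rw [outcomeWeight, Matrix.star_eq_conjTranspose, ← tensorPow_conjTranspose, ← tensorPow_mul,
    ← tensorPow_mul, ← Matrix.star_eq_conjTranspose, tensorPow, Matrix.of_apply]
  simp_rw [← ofReal_outcomeWeight hA]
  rw [← Complex.ofReal_prod, Complex.ofReal_re]

variable [DecidableEq ι]

lemma trace_conj_diagonal_mul (U A : Matrix ι ι ℂ) (b : ι → ℝ) :
    (U * Matrix.diagonal (fun i => (b i : ℂ)) * star U * A).trace.re =
      ∑ i, b i * outcomeWeight U A i := by
  rw [Matrix.mul_assoc, Matrix.mul_assoc, Matrix.trace_mul_comm, Matrix.mul_assoc]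
  simp [Matrix.trace, outcomeWeight]

lemma sum_outcomeWeight (hU : U ∈ Matrix.unitaryGroup ι ℂ) (A : Matrix ι ι ℂ) :
    ∑ i, outcomeWeight U A i = A.trace.re := by
  have h := trace_conj_diagonal_mul U A 1
  simpa [Matrix.mem_unitaryGroup_iff.mp hU] using h.symm

end OutcomeWeight

section LawOfLargeNumbers

open MeasureTheory ProbabilityTheory

lemma tendsto_measureReal_pi_deviation_gt {Ω : Type*} [MeasurableSpace Ω] (μ : Measure Ω)
    [IsProbabilityMeasure μ] {X : Ω → ℝ} (hX : MemLp X 2 μ) {δ : ℝ} (hδ : 0 < δ) :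
    Tendsto (fun n : ℕ =>
        (Measure.pi fun _ : Fin n => μ).real {ω | n * δ < |∑ k, X (ω k) - n * μ[X]|})
      atTop (𝓝 0) := by
  have chebyshev (n : ℕ) (hn : 0 < n) :
      (Measure.pi fun _ : Fin n => μ).real {ω | n * δ < |∑ k, X (ω k) - n * μ[X]|} ≤
        Var[X; μ] / δ ^ 2 / n := by
    have hL2 (k : Fin n) : MemLp (fun ω : Fin n → Ω => X (ω k)) 2 (Measure.pi fun _ => μ) :=
      hX.comp_measurePreserving (measurePreserving_eval _ k)
    have hmean : ∫ ω, (∑ k, fun ω : Fin n → Ω => X (ω k)) ω ∂(Measure.pi fun _ => μ) =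
        n * μ[X] := by
      simp only [Finset.sum_apply]
      rw [integral_finsetSum _ fun k _ => (hL2 k).integrable one_le_two]
      simp [integral_comp_eval (μ := fun _ => μ) hX.aestronglyMeasurable]
    have hvar : Var[∑ k : Fin n, fun ω => X (ω k); Measure.pi fun _ => μ] = n * Var[X; μ] := by
      rw [variance_sum_pi fun _ => hX]
      simp
    have h := meas_ge_le_variance_div_sq (memLp_finsetSum' Finset.univ fun k _ => hL2 k)
      (c := n * δ) (by positivity)
    rw [hmean, hvar] at h
    rw [show Var[X; μ] / δ ^ 2 / n = n * Var[X; μ] / (n * δ) ^ 2 by field_simp]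
    refine ENNReal.toReal_le_of_le_ofReal (by positivity [variance_nonneg X μ]) ?_
    refine (measure_mono fun ω hω => ?_).trans h
    simpa using (Set.mem_ofPred.mp hω).le
  exact squeeze_zero' (.of_forall fun n => measureReal_nonneg)
    ((eventually_gt_atTop 0).mono chebyshev) (tendsto_const_div_atTop_nhds_zero_nat _)

lemma tendsto_sum_prod_deviation_gt {ι : Type*} [Fintype ι] {w : ι → ℝ} (hw : w ∈ stdSimplex ℝ ι)
    (g : ι → ℝ) {δ : ℝ} (hδ : 0 < δ) :
    Tendsto (fun n : ℕ =>
        ∑ I : Fin n → ι with n * δ < |∑ k, g (I k) - n * ∑ i, w i * g i|, ∏ k, w (I k))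
      atTop (𝓝 0) := by
  let _ : MeasurableSpace ι := ⊤
  let p : PMF ι := .ofFintype (fun i => ENNReal.ofReal (w i)) <| by
    rw [← ENNReal.ofReal_sum_of_nonneg fun i _ => hw.1 i, hw.2, ENNReal.ofReal_one]
  have hp (i : ι) : p.toMeasure.real {i} = w i := by
    rw [measureReal_def, PMF.toMeasure_apply_singleton _ _ (.singleton i), PMF.ofFintype_apply,
      ENNReal.toReal_ofReal (hw.1 i)]
  have hmean : p.toMeasure[g] = ∑ i, w i * g i := by
    simp [integral_fintype .of_finite, hp]
  convert tendsto_measureReal_pi_deviation_gt p.toMeasure (MemLp.of_discrete (f := g)) hδ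
    using 2 with n
  rw [hmean, ← Finset.coe_filter_univ, ← sum_measureReal_singleton]
  refine Finset.sum_congr rfl fun I _ => ?_
  simp only [measureReal_def, Measure.pi_singleton, ENNReal.toReal_prod]
  exact Finset.prod_congr rfl fun k _ => (hp (I k)).symm

end LawOfLargeNumbers

section SpectralDecomposition

variable {κ : Type*} [Fintype κ] [DecidableEq κ] {A V : Matrix κ κ ℂ}

lemma exists_conj_diagonal (hA : 0 ≤ A) :
    ∃ U ∈ Matrix.unitaryGroup κ ℂ, ∃ a : κ → ℝ, 0 ≤ a ∧
      A = U * Matrix.diagonal (fun i => (a i : ℂ)) * star U :=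
  have hpsd := Matrix.nonneg_iff_posSemidef.mp hA
  ⟨_, hpsd.isHermitian.eigenvectorUnitary.2, _, hpsd.eigenvalues_nonneg,
    hpsd.isHermitian.spectral_theorem⟩

lemma trace_cfc_conj_diagonal_mul (hV : V ∈ Matrix.unitaryGroup κ ℂ) (f : ℝ → ℝ) (s : κ → ℝ)
    (A : Matrix κ κ ℂ) :
    (cfc f (V * Matrix.diagonal (fun i => (s i : ℂ)) * star V) * A).trace.re =
      ∑ i, f (s i) * outcomeWeight V A i :=
  (congrArg (fun B => (B * A).trace.re) (cfc_conj_diagonal hV f s)).trans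
    (trace_conj_diagonal_mul V A fun i => f (s i))

lemma typeI_spectralProj_conj_diagonal (hV : V ∈ Matrix.unitaryGroup κ ℂ) (s : κ → ℝ) (S : Set ℝ)
    [DecidablePred (· ∈ S)] (A : Matrix κ κ ℂ) :
    typeI (spectralProj (V * Matrix.diagonal (fun i => (s i : ℂ)) * star V) S) A =
      ∑ i with s i ∉ S, outcomeWeight V A i := by
  rw [typeI, spectralProj, Matrix.sub_mul, Matrix.one_mul, Matrix.trace_sub, Complex.sub_re,
    trace_cfc_conj_diagonal_mul hV]
  rw [← sum_outcomeWeight hV, ← Finset.sum_sub_distrib, Finset.sum_filter]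
  refine Finset.sum_congr rfl fun i _ => ?_
  by_cases hi : s i ∈ S <;> simp [hi]

end SpectralDecomposition

section Support

variable {ι : Type*} [Fintype ι] [DecidableEq ι] {ρ σ : Matrix ι ι ℂ}

lemma supp_le_supp_iff (hσ : IsSelfAdjoint σ) :
    supp ρ ≤ supp σ ↔ spectralProj σ {0}ᶜ * ρ = ρ := by
  constructor
  · intro h
    refine Matrix.ext_of_mulVec_single fun i => ?_
    obtain ⟨x, hx⟩ := h ⟨Pi.single i 1, rfl⟩
    rw [Matrix.mulVecLin_apply, Matrix.mulVecLin_apply] at hx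
    rw [← Matrix.mulVec_mulVec, ← hx, Matrix.mulVec_mulVec, spectralProj_compl_zero_mul hσ]
  · intro h
    rw [← h, spectralProj_compl_zero hσ, Matrix.mul_assoc, supp, Matrix.mulVecLin_mul]
    exact LinearMap.range_comp_le_range _ _

lemma typeI_nonneg {E : Matrix ι ι ℂ} (hE : E ≤ 1) (hρ : 0 ≤ ρ) : 0 ≤ typeI E ρ :=
  (Complex.le_def.mp (trace_mul_nonneg (sub_nonneg.mpr hE) hρ)).1

lemma typeI_eq_zero_iff {E : Matrix ι ι ℂ} (hE : E ≤ 1) (hρ : 0 ≤ ρ) :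
    typeI E ρ = 0 ↔ E * ρ = ρ := by
  have hreal := Complex.eq_re_of_ofReal_le (trace_mul_nonneg (sub_nonneg.mpr hE) hρ)
  rw [typeI, ← Complex.ofReal_eq_zero, ← hreal, trace_mul_eq_zero_iff (sub_nonneg.mpr hE) hρ,
    one_sub_mul, sub_eq_zero, eq_comm]

end Support

section TypicalProjection

variable {ι : Type*} [Fintype ι] [DecidableEq ι] {ρ σ V : Matrix ι ι ℂ} {s : ι → ℝ}

/-- `Tr ρ log σ`, with base `2` and `log` taken to be `0` at the eigenvalue `0`, as in
`relEntropy`. -/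
def meanLog (ρ σ : Matrix ι ι ℂ) : ℝ :=
  (ρ * cfc (Real.logb 2) σ).trace.re

/-- The projection onto the `ρ`-typical eigenspaces of `σ^{⊗n}`: those on which `(1/n) log σ^{⊗n}`
is within `δ` of its mean value in the state `ρ^{⊗n}`. -/
def typicalProj (ρ σ : Matrix ι ι ℂ) (δ : ℝ) (n : ℕ) : Matrix (Fin n → ι) (Fin n → ι) ℂ :=
  spectralProj (tensorPow σ n)
    (Set.Icc (2 ^ (n * (meanLog ρ σ - δ))) (2 ^ (n * (meanLog ρ σ + δ))))

lemma relEntropy_of_supp_le (h : supp ρ ≤ supp σ) :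
    relEntropy ρ σ = ((meanLog ρ ρ - meanLog ρ σ : ℝ) : EReal) := by
  rw [relEntropy, if_pos h, meanLog, meanLog, Matrix.mul_sub, Matrix.trace_sub, Complex.sub_re]

lemma meanLog_conj_diagonal (hV : V ∈ Matrix.unitaryGroup ι ℂ) (s : ι → ℝ) (ρ : Matrix ι ι ℂ) :
    meanLog ρ (V * Matrix.diagonal (fun i => (s i : ℂ)) * star V) =
      ∑ i, outcomeWeight V ρ i * Real.logb 2 (s i) := by
  rw [meanLog, Matrix.trace_mul_comm, trace_cfc_conj_diagonal_mul hV]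
  exact Finset.sum_congr rfl fun i _ => mul_comm _ _

lemma tensorPow_conj_diagonal (V : Matrix ι ι ℂ) (s : ι → ℝ) (n : ℕ) :
    tensorPow (V * Matrix.diagonal (fun i => (s i : ℂ)) * star V) n =
      tensorPow V n * Matrix.diagonal (fun I => ((∏ k, s (I k) : ℝ) : ℂ)) *
        star (tensorPow V n) := by
  simp only [Matrix.star_eq_conjTranspose, tensorPow_mul, tensorPow_diagonal,
    tensorPow_conjTranspose, Complex.ofReal_prod]

lemma outcomeWeight_eq_zero_of_supp_le (hV : V ∈ Matrix.unitaryGroup ι ℂ) (hρ : 0 ≤ ρ)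
    (h : supp ρ ≤ supp (V * Matrix.diagonal (fun i => (s i : ℂ)) * star V)) {j : ι}
    (hj : s j = 0) : outcomeWeight V ρ j = 0 := by
  classical
  have hσ : IsSelfAdjoint (V * Matrix.diagonal (fun i => (s i : ℂ)) * star V) :=
    Matrix.isHermitian_mul_mul_conjTranspose V <|
      Matrix.isHermitian_diagonal_iff.mpr fun i => RCLike.conj_ofReal (s i)
  have hsum := (typeI_eq_zero_iff (isStarProjection_spectralProj _ _).le_one hρ).mpr
    ((supp_le_supp_iff hσ).mp h)
  rw [typeI_spectralProj_conj_diagonal hV,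
    Finset.sum_eq_zero_iff_of_nonneg fun i _ => outcomeWeight_nonneg hρ V i] at hsum
  exact hsum j (by simp [hj])

lemma prod_mem_Icc_two_rpow {n : ℕ} {x : Fin n → ℝ} (hx : ∀ k, 0 < x k) {L δ : ℝ}
    (h : |∑ k, Real.logb 2 (x k) - n * L| ≤ n * δ) :
    ∏ k, x k ∈ Set.Icc ((2 : ℝ) ^ (n * (L - δ))) (2 ^ (n * (L + δ))) := by
  have hprod : ∏ k, x k = (2 : ℝ) ^ ∑ k, Real.logb 2 (x k) := by
    rw [Real.rpow_sum_of_pos two_pos]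
    exact Finset.prod_congr rfl fun k _ =>
      (Real.rpow_logb two_pos (by norm_num) (hx k)).symm
  rw [hprod, Set.mem_Icc, Real.rpow_le_rpow_left_iff one_lt_two,
    Real.rpow_le_rpow_left_iff one_lt_two]
  constructor <;> linarith [abs_le.mp h]

lemma typeI_typicalProj_le (hV : V ∈ Matrix.unitaryGroup ι ℂ) (hρ : 0 ≤ ρ) (hs : 0 ≤ s)
    (h : supp ρ ≤ supp (V * Matrix.diagonal (fun i => (s i : ℂ)) * star V)) (δ : ℝ) (n : ℕ) :
    typeI (typicalProj ρ (V * Matrix.diagonal (fun i => (s i : ℂ)) * star V) δ n) (tensorPow ρ n) ≤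
      ∑ I : Fin n → ι with n * δ < |∑ k, Real.logb 2 (s (I k)) -
          n * ∑ i, outcomeWeight V ρ i * Real.logb 2 (s i)|,
        ∏ k, outcomeWeight V ρ (I k) := by
  classical
  rw [typicalProj, tensorPow_conj_diagonal,
    typeI_spectralProj_conj_diagonal (tensorPow_mem_unitaryGroup hV n)]
  simp only [outcomeWeight_tensorPow hρ]
  rw [← Finset.sum_filter_ne_zero]
  refine Finset.sum_le_sum_of_subset_of_nonneg (fun I hI => ?_)
    fun I _ _ => Finset.prod_nonneg fun k _ => outcomeWeight_nonneg hρ V (I k)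
  simp only [Finset.mem_filter, Finset.mem_univ, true_and, Finset.prod_ne_zero_iff] at hI ⊢
  have hpos (k : Fin n) : 0 < s (I k) :=
    (hs (I k)).lt_of_ne' (mt (outcomeWeight_eq_zero_of_supp_le hV hρ h) (hI.2 k trivial))
  rw [← meanLog_conj_diagonal hV, ← not_le]
  exact mt (prod_mem_Icc_two_rpow hpos) hI.1

lemma tendsto_typeI_typicalProj (hρ : IsState ρ) (hσ : 0 ≤ σ) (h : supp ρ ≤ supp σ) {δ : ℝ}
    (hδ : 0 < δ) :
    Tendsto (fun n => typeI (typicalProj ρ σ δ n) (tensorPow ρ n)) atTop (𝓝 0) := by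
  obtain ⟨V, hV, s, hs, rfl⟩ := exists_conj_diagonal hσ
  have hρ0 : 0 ≤ ρ := Matrix.nonneg_iff_posSemidef.mpr hρ.1
  have hw : outcomeWeight V ρ ∈ stdSimplex ℝ ι :=
    ⟨outcomeWeight_nonneg hρ0 V, by simp [sum_outcomeWeight hV, hρ.2]⟩
  exact squeeze_zero
    (fun n => typeI_nonneg (isStarProjection_spectralProj _ _).le_one (tensorPow_nonneg hρ0 n))
    (typeI_typicalProj_le hV hρ0 hs h δ)
    (tendsto_sum_prod_deviation_gt hw (fun i => Real.logb 2 (s i)) hδ)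

lemma trace_typicalProj_self_le (hρ : IsState ρ) (δ : ℝ) (n : ℕ) :
    (typicalProj ρ ρ δ n).trace.re ≤ 2 ^ (n * (δ - meanLog ρ ρ)) := by
  have hρn : 0 ≤ tensorPow ρ n := tensorPow_nonneg (Matrix.nonneg_iff_posSemidef.mpr hρ.1) n
  have hle : (2 : ℝ) ^ (n * (meanLog ρ ρ - δ)) • typicalProj ρ ρ δ n ≤ tensorPow ρ n :=
    smul_spectralProj_le hρn Set.Icc_subset_Ici_self
  have htrace := (Complex.le_def.mp (trace_le_trace hle)).1
  rwa [trace_tensorPow, hρ.2, one_pow, Complex.one_re, Matrix.trace_smul, Complex.smul_re,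
    smul_eq_mul, ← le_div_iff₀' (by positivity), one_div, ← Real.rpow_neg zero_le_two, ← mul_neg,
    neg_sub] at htrace

end TypicalProjection

section Errors

variable {κ : Type*} [Fintype κ] {P Q ρ σ τ E F : Matrix κ κ ℂ}

lemma typeII_mono_left (h : P ≤ Q) (hσ : 0 ≤ σ) : typeII P σ ≤ typeII Q σ :=
  (Complex.le_def.mp (trace_mul_le_trace_mul_right hσ h)).1

lemma typeII_mono_right (hP : 0 ≤ P) (h : σ ≤ τ) : typeII P σ ≤ typeII P τ :=
  (Complex.le_def.mp (trace_mul_le_trace_mul_left hP h)).1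

lemma typeII_smul_right (c : ℝ) (P σ : Matrix κ κ ℂ) : typeII P (c • σ) = c * typeII P σ := by
  simp [typeII]

lemma typeII_conjugate (E P σ : Matrix κ κ ℂ) : typeII (E * P * E) σ = typeII P (E * σ * E) := by
  rw [typeII, typeII, Matrix.mul_assoc, Matrix.mul_assoc, Matrix.trace_mul_comm]
  simp only [Matrix.mul_assoc]

variable [DecidableEq κ]

lemma isTest_iff : IsTest P ↔ 0 ≤ P ∧ P ≤ 1 := by
  rw [IsTest, Matrix.nonneg_iff_posSemidef, Matrix.le_iff]

lemma typeI_eq_sub_typeII (P ρ : Matrix κ κ ℂ) : typeI P ρ = ρ.trace.re - typeII P ρ := by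
  simp [typeI, typeII, Matrix.sub_mul]

lemma typeI_mono_right (hP : P ≤ 1) (h : ρ ≤ τ) : typeI P ρ ≤ typeI P τ :=
  typeII_mono_right (sub_nonneg.mpr hP) h

lemma typeII_le_pinching (hE : IsStarProjection E) (hP : 0 ≤ P) (hP1 : P ≤ 1) (hρ : 0 ≤ ρ) :
    typeII P ρ ≤ 2 * typeII (E * P * E) ρ + 2 * typeI E ρ := by
  have hpinch := typeII_mono_left (le_two_nsmul_pinching hE.isSelfAdjoint hP) hρ
  have hcompl : typeII ((1 - E) * P * (1 - E)) ρ ≤ typeI E ρ :=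
    typeII_mono_left (conjugate_le_of_isStarProjection hE.one_sub hP1) hρ
  have hsplit : typeII (2 • (E * P * E + (1 - E) * P * (1 - E))) ρ =
      2 * (typeII (E * P * E) ρ + typeII ((1 - E) * P * (1 - E)) ρ) := by
    simp only [typeII, two_nsmul, Matrix.add_mul, Matrix.trace_add, Complex.add_re]
    ring
  linarith

lemma typeII_le_typeII_conjugate_add_typeI (hF : IsStarProjection F) (hFρ : Commute F ρ)
    (hρ : 0 ≤ ρ) (hP1 : P ≤ 1) : typeII P ρ ≤ typeII P (F * ρ * F) + typeI F ρ := by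
  have hX : F * ρ * F ≤ ρ := conjugate_le_of_commute hF hFρ hρ
  have hle : typeII P (ρ - F * ρ * F) ≤ typeII 1 (ρ - F * ρ * F) :=
    typeII_mono_left hP1 (sub_nonneg.mpr hX)
  have htrace : (F * ρ * F).trace = (F * ρ).trace := by
    rw [Matrix.trace_mul_comm, ← Matrix.mul_assoc, hF.isIdempotentElem.eq]
  simp only [typeI, typeII, Matrix.mul_sub, Matrix.sub_mul, Matrix.one_mul, Matrix.trace_sub,
    Complex.sub_re, htrace] at hle ⊢
  linarith

lemma typeII_conjugate_le_of_smul_le (hE : IsStarProjection E) (hP : 0 ≤ P) {α c : ℝ}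
    (hα : 0 ≤ α) (hρ : ρ ≤ α • 1) (hc : 0 < c) (hσ : c • E ≤ σ) :
    typeII (E * P * E) ρ ≤ α / c * typeII P σ := by
  have hEPE : typeII (E * P * E) ρ ≤ α * typeII P E := by
    refine (typeII_mono_right (hE.isSelfAdjoint.conjugate_nonneg hP) hρ).trans_eq ?_
    rw [typeII_smul_right, typeII_conjugate, Matrix.mul_one, hE.isIdempotentElem.eq]
  have hPE : c * typeII P E ≤ typeII P σ := typeII_smul_right c P E ▸ typeII_mono_right hP hσ
  calc typeII (E * P * E) ρ ≤ α * typeII P E := hEPE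
    _ ≤ α * (typeII P σ / c) := by gcongr; rwa [le_div_iff₀' hc]
    _ = α / c * typeII P σ := by ring

lemma typeII_le_of_smul_le (hE : IsStarProjection E) (hF : IsStarProjection F)
    (hFρ : Commute F ρ) (hρ : 0 ≤ ρ) (hP : 0 ≤ P) (hP1 : P ≤ 1) {α c : ℝ} (hα : 0 ≤ α)
    (hFα : F * ρ * F ≤ α • 1) (hc : 0 < c) (hσ : c • E ≤ σ) :
    typeII P ρ ≤ 2 * (α / c * typeII P σ) + 2 * typeI E ρ + typeI F ρ := by
  have hX0 : 0 ≤ F * ρ * F := hF.isSelfAdjoint.conjugate_nonneg hρ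
  have hcut := typeII_le_typeII_conjugate_add_typeI hF hFρ hρ hP1
  have hpinch := typeII_le_pinching hE hP hP1 hX0
  have hmain := typeII_conjugate_le_of_smul_le hE hP hα hFα hc hσ
  have hmono := typeI_mono_right hE.le_one (conjugate_le_of_commute hF hFρ hρ)
  linarith

lemma isTest_conjugate (hE : IsStarProjection E) (hP : 0 ≤ P) (hP1 : P ≤ 1) :
    IsTest (E * P * E) :=
  isTest_iff.mpr ⟨hE.isSelfAdjoint.conjugate_nonneg hP,
    (conjugate_le_of_isStarProjection hE hP1).trans hE.le_one⟩

lemma typeII_conjugate_le (hP : 0 ≤ P) {b : ℝ} (h : E * σ * E ≤ b • 1) :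
    typeII (E * P * E) σ ≤ b * P.trace.re := by
  rw [typeII_conjugate]
  refine (typeII_mono_right hP h).trans_eq ?_
  rw [typeII_smul_right, typeII, Matrix.mul_one]

lemma typeI_conjugate_le (hE : IsStarProjection E) (hP : 0 ≤ P) (hP1 : P ≤ 1) (hρ : 0 ≤ ρ) :
    typeI (E * P * E) ρ ≤ (ρ.trace.re + typeI P ρ) / 2 + typeI E ρ := by
  have hpinch := typeII_le_pinching hE hP hP1 hρ
  rw [typeI_eq_sub_typeII] at hpinch ⊢
  rw [typeI_eq_sub_typeII P, typeI_eq_sub_typeII E]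
  linarith

end Errors

section Exponents

variable {n : ℕ} {t c : ℝ}

lemma one_div_mul_log2_le (hn : 0 < n) (h : t ≤ (2 : ℝ) ^ (n * c)) :
    ((1 / n : ℝ) : EReal) * log2 t ≤ (c : EReal) := by
  have hn' : (0 : ℝ) < n := by exact_mod_cast hn
  unfold log2
  split_ifs with ht
  · rw [EReal.coe_mul_bot_of_pos (by positivity)]
    exact bot_le
  · rw [← EReal.coe_mul, EReal.coe_le_coe_iff, one_div, inv_mul_le_iff₀ hn']
    exact (Real.logb_le_iff_le_rpow one_lt_two (not_le.mp ht)).mpr h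

lemma le_rpow_of_one_div_mul_log2_lt (hn : 0 < n)
    (h : ((1 / n : ℝ) : EReal) * log2 t < (c : EReal)) : t ≤ (2 : ℝ) ^ (n * c) := by
  have hn' : (0 : ℝ) < n := by exact_mod_cast hn
  unfold log2 at h
  split_ifs at h with ht
  · exact ht.trans (by positivity)
  · rw [← EReal.coe_mul, EReal.coe_lt_coe_iff, one_div, inv_mul_lt_iff₀ hn'] at h
    exact (Real.logb_le_iff_le_rpow one_lt_two (not_le.mp ht)).mp h.le

end Exponents

section Rates

variable {ι : Type*} [Fintype ι] [DecidableEq ι] {ρ σ : Matrix ι ι ℂ} {R : ℝ}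

lemma not_isStrongConverse_of_typeI_le {P : (n : ℕ) → Matrix (Fin n → ι) (Fin n → ι) ℂ}
    (hP : ∀ n, IsTest (P n)) (hII : ∀ n, typeII (P n) (tensorPow σ n) ≤ (2 : ℝ) ^ (n * (-R)))
    {e : ℕ → ℝ} (hI : ∀ n, typeI (P n) (tensorPow ρ n) ≤ e n) {c : ℝ} (hc : c < 1)
    (he : Tendsto e atTop (𝓝 c)) : ¬ IsStrongConverse ρ σ R := by
  intro h
  refine hc.not_ge (le_of_tendsto_of_tendsto' (h P hP ?_) he hI)
  exact limsup_le_of_le (h := (eventually_gt_atTop 0).mono fun n hn =>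
    one_div_mul_log2_le hn (hII n))

lemma not_isStrongConverse_of_not_supp_le (hρ : IsState ρ) (hσ : IsSelfAdjoint σ)
    (h : ¬ supp ρ ≤ supp σ) (R : ℝ) : ¬ IsStrongConverse ρ σ R := by
  have hρ0 : 0 ≤ ρ := Matrix.nonneg_iff_posSemidef.mpr hρ.1
  set E := spectralProj σ {0}ᶜ with hEdef
  have hE : IsStarProjection E := isStarProjection_spectralProj σ _
  have hEn (n : ℕ) := isStarProjection_tensorPow hE n
  have htypeI : 0 < typeI E ρ := (typeI_nonneg hE.le_one hρ0).lt_of_ne' <| by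
    rwa [Ne, typeI_eq_zero_iff hE.le_one hρ0, ← supp_le_supp_iff hσ]
  have hEρ : (E * ρ).trace = (typeII E ρ : ℂ) :=
    Complex.eq_re_of_ofReal_le (trace_mul_nonneg hE.nonneg hρ0)
  have hlt : typeII E ρ < 1 := by simpa [typeI_eq_sub_typeII, hρ.2] using htypeI
  have hnonneg : 0 ≤ typeII E ρ := (Complex.le_def.mp (trace_mul_nonneg hE.nonneg hρ0)).1
  refine not_isStrongConverse_of_typeI_le (P := fun n => 1 - tensorPow E n)
    (fun n => isTest_iff.mpr ⟨(hEn n).one_sub.nonneg, (hEn n).one_sub.le_one⟩)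
    (fun n => ?_) (fun n => le_of_eq ?_) zero_lt_one
    (tendsto_pow_atTop_nhds_zero_of_lt_one hnonneg hlt)
  · rw [typeII, Matrix.sub_mul, Matrix.one_mul, ← tensorPow_mul, hEdef,
      spectralProj_compl_zero_mul hσ, sub_self, Matrix.trace_zero, Complex.zero_re]
    positivity
  · rw [typeI, sub_sub_cancel, ← tensorPow_mul, trace_tensorPow, hEρ, ← Complex.ofReal_pow,
      Complex.ofReal_re]

lemma not_isStrongConverse_of_lt (hρ : IsState ρ) (hσ : 0 ≤ σ) (h : supp ρ ≤ supp σ)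
    (hR : R < meanLog ρ ρ - meanLog ρ σ) : ¬ IsStrongConverse ρ σ R := by
  have hρ0 : 0 ≤ ρ := Matrix.nonneg_iff_posSemidef.mpr hρ.1
  obtain ⟨δ, hδ, hδR⟩ : ∃ δ > 0, meanLog ρ σ + δ + (δ - meanLog ρ ρ) = -R :=
    ⟨(meanLog ρ ρ - meanLog ρ σ - R) / 2, by linarith, by ring⟩
  let E := typicalProj ρ σ δ
  let F := typicalProj ρ ρ δ
  have hE (n : ℕ) : IsStarProjection (E n) := isStarProjection_spectralProj _ _
  have hF (n : ℕ) : IsStarProjection (F n) := isStarProjection_spectralProj _ _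
  have hlim : Tendsto (fun n => (1 + typeI (F n) (tensorPow ρ n)) / 2 +
      typeI (E n) (tensorPow ρ n)) atTop (𝓝 ((1 + 0) / 2 + 0)) :=
    (((tendsto_typeI_typicalProj hρ hρ0 le_rfl hδ).const_add 1).div_const 2).add
      (tendsto_typeI_typicalProj hρ hσ h hδ)
  refine not_isStrongConverse_of_typeI_le (P := fun n => E n * F n * E n)
    (fun n => isTest_conjugate (hE n) (hF n).nonneg (hF n).le_one)
    (fun n => ?_) (fun n => ?_) (by norm_num) hlim
  · have hEσ : E n * tensorPow σ n * E n ≤ (2 : ℝ) ^ (n * (meanLog ρ σ + δ)) • 1 :=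
      conjugate_spectralProj_le (tensorPow_nonneg hσ n).isSelfAdjoint (by positivity)
        Set.Icc_subset_Iic_self
    calc typeII (E n * F n * E n) (tensorPow σ n)
        ≤ 2 ^ (n * (meanLog ρ σ + δ)) * (F n).trace.re := typeII_conjugate_le (hF n).nonneg hEσ
      _ ≤ 2 ^ (n * (meanLog ρ σ + δ)) * 2 ^ (n * (δ - meanLog ρ ρ)) := by
        gcongr
        exact trace_typicalProj_self_le hρ δ n
      _ = 2 ^ (n * (-R)) := by rw [← Real.rpow_add two_pos, ← mul_add, hδR]
  · simpa [trace_tensorPow, hρ.2] using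
      typeI_conjugate_le (hE n) (hF n).nonneg (hF n).le_one (tensorPow_nonneg hρ0 n)

lemma typeII_tensorPow_le_typicalProj (hρ : 0 ≤ ρ) (hσ : 0 ≤ σ) (δ : ℝ) {n : ℕ}
    {P : Matrix (Fin n → ι) (Fin n → ι) ℂ} (hP : IsTest P) :
    typeII P (tensorPow ρ n) ≤
      2 * (2 ^ (n * (meanLog ρ ρ - meanLog ρ σ + 2 * δ)) * typeII P (tensorPow σ n)) +
        2 * typeI (typicalProj ρ σ δ n) (tensorPow ρ n) +
        typeI (typicalProj ρ ρ δ n) (tensorPow ρ n) := by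
  have hρn := tensorPow_nonneg hρ n
  have hF : typicalProj ρ ρ δ n * tensorPow ρ n * typicalProj ρ ρ δ n ≤
      (2 : ℝ) ^ (n * (meanLog ρ ρ + δ)) • 1 :=
    conjugate_spectralProj_le hρn.isSelfAdjoint (by positivity) Set.Icc_subset_Iic_self
  have hE : (2 : ℝ) ^ (n * (meanLog ρ σ - δ)) • typicalProj ρ σ δ n ≤ tensorPow σ n :=
    smul_spectralProj_le (tensorPow_nonneg hσ n) Set.Icc_subset_Ici_self
  obtain ⟨hP0, hP1⟩ := isTest_iff.mp hP
  have hbound := typeII_le_of_smul_le (isStarProjection_spectralProj _ _)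
    (isStarProjection_spectralProj _ _) (commute_spectralProj _ _) hρn hP0 hP1 (by positivity) hF
    (by positivity) hE
  rw [← Real.rpow_sub two_pos, ← mul_sub] at hbound
  rwa [show meanLog ρ ρ - meanLog ρ σ + 2 * δ = meanLog ρ ρ + δ - (meanLog ρ σ - δ) by ring]

lemma isStrongConverse_of_lt (hρ : IsState ρ) (hσ : 0 ≤ σ) (h : supp ρ ≤ supp σ)
    (hR : meanLog ρ ρ - meanLog ρ σ < R) : IsStrongConverse ρ σ R := by
  intro P hP hlim
  have hρ0 : 0 ≤ ρ := Matrix.nonneg_iff_posSemidef.mpr hρ.1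
  obtain ⟨δ, hδ, hδR⟩ : ∃ δ > 0, meanLog ρ ρ - meanLog ρ σ + 2 * δ + (-R + δ) = -δ :=
    ⟨(R - (meanLog ρ ρ - meanLog ρ σ)) / 4, by linarith, by ring⟩
  have hII : ∀ᶠ n : ℕ in atTop, typeII (P n) (tensorPow σ n) ≤ (2 : ℝ) ^ (n * (-R + δ)) := by
    have hlt : ((-R : ℝ) : EReal) < ((-R + δ : ℝ) : EReal) :=
      EReal.coe_lt_coe_iff.mpr (by linarith)
    filter_upwards [eventually_lt_of_limsup_lt (hlim.trans_lt hlt), eventually_gt_atTop 0]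
      with n hn hn0 using le_rpow_of_one_div_mul_log2_lt hn0 hn
  have hgeom : Tendsto (fun n : ℕ => ((2 : ℝ) ^ (-δ)) ^ n) atTop (𝓝 0) :=
    tendsto_pow_atTop_nhds_zero_of_lt_one (by positivity)
      (Real.rpow_lt_one_of_one_lt_of_neg one_lt_two (neg_neg_of_pos hδ))
  have hlower : Tendsto (fun n : ℕ => 1 - (2 * ((2 : ℝ) ^ (-δ)) ^ n +
      2 * typeI (typicalProj ρ σ δ n) (tensorPow ρ n) +
      typeI (typicalProj ρ ρ δ n) (tensorPow ρ n))) atTop (𝓝 (1 - (2 * 0 + 2 * 0 + 0))) :=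
    (((hgeom.const_mul 2).add ((tendsto_typeI_typicalProj hρ hσ h hδ).const_mul 2)).add
      (tendsto_typeI_typicalProj hρ hρ0 le_rfl hδ)).const_sub 1
  have htypeI (n : ℕ) : typeI (P n) (tensorPow ρ n) = 1 - typeII (P n) (tensorPow ρ n) := by
    rw [typeI_eq_sub_typeII, trace_tensorPow, hρ.2, one_pow, Complex.one_re]
  refine tendsto_of_tendsto_of_tendsto_of_le_of_le' (by simpa using hlower) tendsto_const_nhds
    (hII.mono fun n hn => ?_) (.of_forall fun n => ?_)
  · have hbound := typeII_tensorPow_le_typicalProj hρ0 hσ δ (hP n)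
    have hdecay : 2 ^ (n * (meanLog ρ ρ - meanLog ρ σ + 2 * δ)) * typeII (P n) (tensorPow σ n) ≤
        ((2 : ℝ) ^ (-δ)) ^ n := by
      refine (mul_le_mul_of_nonneg_left hn (by positivity)).trans_eq ?_
      rw [← Real.rpow_add two_pos, ← mul_add, hδR, ← Real.rpow_mul_natCast zero_le_two, mul_comm]
    linarith [htypeI n]
  · have hpos : 0 ≤ typeII (P n) (tensorPow ρ n) := (Complex.le_def.mp
      (trace_mul_nonneg (isTest_iff.mp (hP n)).1 (tensorPow_nonneg hρ0 n))).1
    linarith [htypeI n]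

lemma isStrongConverse_of_relEntropy_lt (hρ : IsState ρ) (hσ : 0 ≤ σ)
    (hR : relEntropy ρ σ < (R : EReal)) : IsStrongConverse ρ σ R := by
  by_cases h : supp ρ ≤ supp σ
  · rw [relEntropy_of_supp_le h, EReal.coe_lt_coe_iff] at hR
    exact isStrongConverse_of_lt hρ hσ h hR
  · exact absurd hR (by simp [relEntropy, h])

lemma not_isStrongConverse_of_lt_relEntropy (hρ : IsState ρ) (hσ : 0 ≤ σ)
    (hR : (R : EReal) < relEntropy ρ σ) : ¬ IsStrongConverse ρ σ R := by
  by_cases h : supp ρ ≤ supp σ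
  · rw [relEntropy_of_supp_le h, EReal.coe_lt_coe_iff] at hR
    exact not_isStrongConverse_of_lt hρ hσ h hR
  · exact not_isStrongConverse_of_not_supp_le hρ hσ.isSelfAdjoint h R

end Rates

end QHT

end

theorem mainTheorem5_general {ι : Type*} [Fintype ι] [DecidableEq ι] (ρ σ : Matrix ι ι ℂ)
    (hρ : QHT.IsState ρ) (hσ : σ.PosSemidef) :
    QHT.strongConverseRate ρ σ = QHT.relEntropy ρ σ ∧
      ∀ R : ℝ, QHT.relEntropy ρ σ < (R : EReal) → QHT.IsStrongConverse ρ σ R := by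
  have hσ0 := Matrix.nonneg_iff_posSemidef.mpr hσ
  refine ⟨le_antisymm ?_ (le_sInf ?_), fun R => QHT.isStrongConverse_of_relEntropy_lt hρ hσ0⟩
  · exact EReal.le_of_forall_lt_iff_le.mp fun R hR =>
      sInf_le ⟨R, QHT.isStrongConverse_of_relEntropy_lt hρ hσ0 hR, rfl⟩
  · rintro _ ⟨R, hR, rfl⟩
    exact not_lt.mp fun hlt => QHT.not_isStrongConverse_of_lt_relEntropy hρ hσ0 hlt hR

theorem mainTheorem5 {ι : Type*} [Fintype ι] [DecidableEq ι] (ρ σ : Matrix ι ι ℂ)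
    (hρ : QHT.IsState ρ) (hσ : QHT.IsState σ) :
    QHT.strongConverseRate ρ σ = QHT.relEntropy ρ σ ∧
      ∀ R : ℝ, QHT.relEntropy ρ σ < (R : EReal) → QHT.IsStrongConverse ρ σ R :=
  mainTheorem5_general ρ σ hρ hσ.1
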